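/- Conventions. Let $P$ be a poset. A subset is directed if it is nonempty and any two of its elements have an upper bound in it; an ideal is a directed lower set; an ideal is principal if it is of the form $\downarrow x=\{y : y\le x\}$; $P$ is a dcpo if every directed subset has a supremum. A subset $U\subseteq P$ is Scott open if it is an upper set and every directed $D\subseteq P$ whose supremum exists and lies in $U$ meets $U$; $\Sigma P$ is $P$ with the topology of Scott open sets. A d-sub-poset of $P$ is a subset $K$, with the induced order, such that $\bigvee_P D\in K$ for every directed $D\subseteq K$ for which $\bigvee_P D$ exists; if $P$ is a dcpo, this is called a sub-dcpo. A $T_0$ space $X$ is locally finite if for every open $U$ and every $x\in U$ there is a finite $F\subseteq X$ such that $\uparrow F$ (in the specialization order) is open and $x\in\uparrow F\subseteq U$. A poset (resp. dcpo) $P$ is an $\ell f_\omega$-poset (resp. $\ell f_\omega$-dcpo) if there are d-sub-posets (resp. sub-dcpos) $K_1\subseteq K_2\subseteq\cdots$ of $P$ such that every $\Sigma K_n$ is locally finite, $P=\bigcup_n K_n$, and a set $U\subseteq P$ is Scott open in $P$ if and only if $U\cap K_n$ is Scott open in $K_n$ for every $n$. A poset (resp. dcpo) $P$ is a $c$-poset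 (resp. $c$-dcpo) if 1. the set of nonprincipal ideals of $P$ is countable (possibly finite or empty), say equal to $\{I_k : k\in N\}$ with $N\subseteq\mathbb N$; 2. for each $k\in N$ there is a strictly increasing sequence $c_{k,1}<c_{k,2}<\cdots$ in $P$ with $I_k=\{x : x\le c_{k,m}\text{ for some }m\}$; and 3. for these sequences, let $H_k$ be $\{c_{k,m} : m\in\mathbb N\}$ together with $\bigvee_m c_{k,m}$ if this supremum exists in $P$. Then $P\setminus\bigcup_{k\in N}H_k=\bigcup_{l\in\mathbb N}T_l$ for some subsets $T_l\subseteq P$ such that every ideal of the poset $T_l$ (with the induced order) is principal. Statement. Let $P_1,\dots,P_n$ be a finite family of $c$-posets (resp. $c$-dcpos). Then $\prod_{i=1}^n P_i$, with the componentwise order, is an $\ell f_\omega$-poset (resp. an $\ell f_\omega$-dcpo), and $\Sigma\prod_{i=1}^n P_i=\prod_{i=1}^n\Sigma P_i$; that is, the Scott topology of the product is the product of the individual Scott topologies. -/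

import Mathlib

/-- A poset is a dcpo if every (nonempty) directed subset has a supremum. -/
def IsDcpo (P : Type*) [PartialOrder P] : Prop :=
  ∀ D : Set P, D.Nonempty → DirectedOn (· ≤ ·) D → ∃ x, IsLUB D x

/-- The Scott topology `σ(P)`: the open sets are the upper sets `U` such that every directed set
whose supremum exists and lies in `U` meets `U`. -/
abbrev scottTopology (P : Type*) [PartialOrder P] : TopologicalSpace P :=
  Topology.scott P Set.univ

/-- The upward closure of `F` in the specialization order (`a ≤ y` iff `a ∈ closure {y}`,
which is `y ⤳ a` in Mathlib). -/
def specializationUp {X : Type*} [TopologicalSpace X] (F : Set X) : Set X :=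
  {y | ∃ a ∈ F, y ⤳ a}

/-- A T₀ space is locally finite if, whenever `x` lies in an open set `U`, there is a finite set
`F` whose upward closure is open, contains `x` and is contained in `U`. -/
structure IsLocallyFiniteSpace (X : Type*) [TopologicalSpace X] : Prop where
  t0 : T0Space X
  exists_finite : ∀ (x : X) (U : Set X), IsOpen U → x ∈ U →
    ∃ F : Set X, F.Finite ∧ IsOpen (specializationUp F) ∧ x ∈ specializationUp F ∧
      specializationUp F ⊆ U

/-- `P` is an `ℓf_ω`-poset: there is an increasing sequence of d-sub-posets `K n` (subsets
containing every supremum, formed in `P`, of a directed subset), with locally finite Scott spaces,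
that covers `P` and determines its Scott topology. -/
def IsLfOmegaPoset (P : Type*) [PartialOrder P] : Prop :=
  ∃ K : ℕ → Set P,
    (∀ n, DirSupClosed (K n)) ∧
    (∀ n, @IsLocallyFiniteSpace (K n) (scottTopology (K n))) ∧
    (∀ n m, n ≤ m → K n ⊆ K m) ∧
    (⋃ n, K n) = Set.univ ∧
    ∀ U : Set P, @IsOpen P (scottTopology P) U ↔
      ∀ n, @IsOpen (K n) (scottTopology (K n)) (Subtype.val ⁻¹' U)

/-- `P` is an `ℓf_ω`-dcpo. In a dcpo every directed supremum exists, so that the sub-dcpos are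
precisely the subsets `K` with `DirSupClosed K`. -/
def IsLfOmegaDcpo (P : Type*) [PartialOrder P] : Prop :=
  IsDcpo P ∧ IsLfOmegaPoset P

/-- `Id_{¬p}(P)`: the ideals that are not of the form `↓x`. -/
def nonPrincipalIdeals (P : Type*) [PartialOrder P] : Set (Order.Ideal P) :=
  {J | ∀ x : P, J ≠ Order.Ideal.principal x}

/-- `P` is a `c`-poset. The nonprincipal ideals are listed as `I k` with `k` in a set `N` of natural
numbers, so that there may be infinitely many, finitely many or none of them. The set
`Set.range (c k) ∪ {x | IsLUB (Set.range (c k)) x}` is the chain with its supremum added if that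
exists. -/
def IsCPoset (P : Type*) [PartialOrder P] : Prop :=
  ∃ (N : Set ℕ) (I : N → Order.Ideal P) (c : N → ℕ → P) (T : ℕ → Set P),
    nonPrincipalIdeals P = Set.range I ∧
    (∀ k, StrictMono (c k) ∧ (I k : Set P) = {x | ∃ m, x ≤ c k m}) ∧
    (⋃ k, (Set.range (c k) ∪ {x | IsLUB (Set.range (c k)) x}))ᶜ = (⋃ l, T l) ∧
    ∀ l, nonPrincipalIdeals (T l) = ∅

/-- `P` is a `c`-dcpo. -/
def IsCDcpo (P : Type*) [PartialOrder P] : Prop :=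
  IsDcpo P ∧ IsCPoset P

/-!
Everything rests on the filtrations `LfFiltration K` of a poset `P` by subsets `K n`: increasing,
covering, closed under directed suprema and *creating no new ones*, such that the relative Scott
topology of each `K n` has a basis of open sets `↑F` with `F` finite, and such that every directed
set of `P` generates the same ideal as a directed set inside some `K n`. The last property makes the
Scott topology of `P` the one determined by the `K n`, so that a poset with such a filtration is an
`ℓf_ω`-poset (`LfFiltration.isLfOmegaPoset`).

*Products.* The ideals of a finite product are the products of ideals, and finitely generated open
boxes can be enlarged one coordinate at a time (`exists_box`): the points `y` for which the
box with `y` in coordinate `j` stays inside a Scott open set form a finite intersection of Scott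
open sets. Hence the products `∏ᵢ Kᵢ n` again form a filtration (`LfFiltration.pi`). For the
topologies (`scottTopology_pi`), let `x` be a point of a Scott open set `U` of the product. Growing
a finite box `∏ᵢ Fᵢ ⊆ U` around `x` successively inside `∏ᵢ Kᵢ n` for larger and larger `n`, so that
`↑Fᵢ` becomes open in `Kᵢ n` each time, produces in the union a box of Scott open sets inside `U`.

*`c`-posets.* A directed set without a greatest element generates a nonprincipal ideal, hence one of
the countably many `I k`. Let `K n` be the union of the chains `c k` for `k ≤ n`, the sets `T l`
for `l ≤ n`, and sets `W k` of upper bounds of the chains for `k ≤ n`. Inside `K n` a directed set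
without a greatest element is cofinal with one of finitely many chains, so to make `↑{x}` open
within an open set it suffices to adjoin one element of each of these chains. The set `W k` is
chosen coinitial among the upper bounds of the chain `c k` and without infinite strictly ascending
sequences (`exists_coinitial_wellFounded`). By the first property a least upper bound of the chain
inside `K n` is a least upper bound in `P`, and that supremum, if it exists, is in `W k`; by the
second property `W k` contributes no directed sets without a greatest element.
-/

open scoped Topology

/-! ### Directed sets -/

theorem DirectedOn.exists_upper_bound_of_finite {P ι : Type*} [Preorder P] {D : Set P}
    (hD : DirectedOn (· ≤ ·) D) (hne : D.Nonempty) {s : Set ι} (hs : s.Finite) (g : ι → P)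
    (hg : ∀ i ∈ s, g i ∈ D) : ∃ d ∈ D, ∀ i ∈ s, g i ≤ d := by
  induction s, hs using Set.Finite.induction_on with
  | empty => exact ⟨hne.some, hne.some_mem, by simp⟩
  | @insert a s _ _ ih =>
    obtain ⟨d, hd, hds⟩ := ih fun i hi => hg i (Set.mem_insert_of_mem _ hi)
    obtain ⟨e, he, hae, hde⟩ := hD (g a) (hg a (Set.mem_insert _ _)) d hd
    refine ⟨e, he, ?_⟩
    rintro i (rfl | hi)
    · exact hae
    · exact (hds i hi).trans hde

/-- If a directed set is covered by finitely many sets, one of them is cofinal in it. -/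
theorem DirectedOn.exists_cofinal_piece {P ι : Type*} [Preorder P] {D : Set P}
    (hD : DirectedOn (· ≤ ·) D) (hne : D.Nonempty) {s : Set ι} (hs : s.Finite) (A : ι → Set P)
    (hA : D ⊆ ⋃ i ∈ s, A i) : ∃ i ∈ s, ∀ d ∈ D, ∃ e ∈ D ∩ A i, d ≤ e := by
  by_contra! hcon
  have : ∀ i, ∃ d ∈ D, i ∈ s → ∀ e ∈ D ∩ A i, ¬ d ≤ e := by
    intro i
    by_cases hi : i ∈ s
    · obtain ⟨d, hd, h⟩ := hcon i hi
      exact ⟨d, hd, fun _ => h⟩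
    · exact ⟨hne.some, hne.some_mem, fun h => absurd h hi⟩
  choose g hgD hg using this
  obtain ⟨d, hd, hgd⟩ := hD.exists_upper_bound_of_finite hne hs g fun i _ => hgD i
  obtain ⟨i, hi, hdi⟩ := Set.mem_iUnion₂.1 (hA hd)
  exact hg i hi d ⟨hd, hdi⟩ (hgd i hi)

theorem DirectedOn.of_cofinal_piece {P : Type*} [Preorder P] {D A : Set P}
    (hD : DirectedOn (· ≤ ·) D) (hA : ∀ d ∈ D, ∃ e ∈ D ∩ A, d ≤ e) :
    DirectedOn (· ≤ ·) (D ∩ A) := by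
  intro x hx y hy
  obtain ⟨z, hz, hxz, hyz⟩ := hD x hx.1 y hy.1
  obtain ⟨e, he, hze⟩ := hA z hz
  exact ⟨e, he, hxz.trans hze, hyz.trans hze⟩

/-- `IsLUB` depends only on the lower closure of a set. -/
theorem IsLUB.of_cofinal {P : Type*} [Preorder P] {D E : Set P} {a : P} (ha : IsLUB D a)
    (hED : ∀ e ∈ E, ∃ d ∈ D, e ≤ d) (hDE : ∀ d ∈ D, ∃ e ∈ E, d ≤ e) : IsLUB E a := by
  refine ⟨fun e he => ?_, fun b hb => ha.2 fun d hd => ?_⟩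
  · obtain ⟨d, hd, hed⟩ := hED e he
    exact hed.trans (ha.1 hd)
  · obtain ⟨e, he, hde⟩ := hDE d hd
    exact hde.trans (hb he)

/-- The ideal generated by a directed set. -/
def DirectedOn.lowerIdeal {P : Type*} [Preorder P] {D : Set P} (hD : DirectedOn (· ≤ ·) D)
    (hne : D.Nonempty) : Order.Ideal P where
  toLowerSet := lowerClosure D
  nonempty' := hne.mono subset_lowerClosure
  directed' := by
    rintro x ⟨d, hd, hxd⟩ y ⟨e, he, hye⟩
    obtain ⟨z, hz, hdz, hez⟩ := hD d hd e he
    exact ⟨z, subset_lowerClosure hz, hxd.trans hdz, hye.trans hez⟩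

theorem DirectedOn.mem_lowerIdeal {P : Type*} [Preorder P] {D : Set P}
    (hD : DirectedOn (· ≤ ·) D) (hne : D.Nonempty) {x : P} :
    x ∈ hD.lowerIdeal hne ↔ ∃ d ∈ D, x ≤ d := Iff.rfl

theorem DirectedOn.exists_greatest_of_lowerIdeal_eq {P : Type*} [PartialOrder P] {D : Set P}
    (hD : DirectedOn (· ≤ ·) D) (hne : D.Nonempty) {x : P}
    (h : hD.lowerIdeal hne = Order.Ideal.principal x) : IsGreatest D x := by
  have hle : ∀ y, (∃ d ∈ D, y ≤ d) ↔ y ≤ x := fun y => by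
    rw [← hD.mem_lowerIdeal hne, h, Order.Ideal.mem_principal]
  obtain ⟨d, hd, hxd⟩ := (hle x).2 le_rfl
  have hub : ∀ e ∈ D, e ≤ x := fun e he => (hle e).1 ⟨e, he, le_rfl⟩
  obtain rfl : d = x := le_antisymm (hub d hd) hxd
  exact ⟨hd, hub⟩

/-- If all ideals of the subposet `T` are principal, directed subsets of `T` have a greatest
element. -/
theorem DirectedOn.exists_greatest_of_nonPrincipalIdeals_eq_empty {P : Type*} [PartialOrder P]
    {T D : Set P} (hT : nonPrincipalIdeals T = ∅) (hDT : D ⊆ T) (hD : DirectedOn (· ≤ ·) D)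
    (hne : D.Nonempty) : ∃ x, IsGreatest D x := by
  let D' : Set T := Subtype.val ⁻¹' D
  have hD' : DirectedOn (· ≤ ·) D' := by
    intro x hx y hy
    obtain ⟨z, hz, h⟩ := hD x hx y hy
    exact ⟨⟨z, hDT hz⟩, hz, h⟩
  have hne' : D'.Nonempty := ⟨⟨hne.some, hDT hne.some_mem⟩, hne.some_mem⟩
  have hnot : hD'.lowerIdeal hne' ∉ nonPrincipalIdeals T := by simp [hT]
  simp only [nonPrincipalIdeals, Set.mem_ofPred_eq, not_forall, not_not] at hnot
  obtain ⟨x, hx⟩ := hnot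
  have hg := hD'.exists_greatest_of_lowerIdeal_eq hne' hx
  exact ⟨x, hg.1, fun d hd => hg.2 (show (⟨d, hDT hd⟩ : T) ∈ D' from hd)⟩

theorem DirectedOn.exists_greatest_of_wellFoundedOn {P : Type*} [PartialOrder P] {W D : Set P}
    (hW : W.WellFoundedOn (· > ·)) (hDW : D ⊆ W) (hD : DirectedOn (· ≤ ·) D)
    (hne : D.Nonempty) : ∃ x, IsGreatest D x := by
  have hwf : D.WellFoundedOn (· > ·) := hW.subset hDW
  obtain ⟨x, -, hmin⟩ := WellFounded.has_min hwf Set.univ ⟨⟨hne.some, hne.some_mem⟩, trivial⟩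
  refine ⟨x, x.2, fun d hd => ?_⟩
  obtain ⟨z, hz, hxz, hdz⟩ := hD x x.2 d hd
  have hxz' : x = z := hxz.eq_of_not_lt (hmin ⟨z, hz⟩ trivial)
  exact hxz' ▸ hdz

/-- Every set of a partial order has a coinitial subset without infinite strictly ascending
sequences. -/
theorem exists_coinitial_wellFounded {P : Type*} [PartialOrder P] (B : Set P) :
    ∃ W ⊆ B, W.WellFoundedOn (· > ·) ∧ ∀ b ∈ B, ∃ w ∈ W, w ≤ b := by
  -- Fix a well-order of `P` and keep the elements of `B` that are not above an earlier element of
  -- `B`. An ascending sequence of such elements descends in the well-order.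
  let r : P → P → Prop := WellOrderingRel
  have hr : WellFounded r := WellOrderingRel.isWellOrder.wf
  refine ⟨{b ∈ B | ∀ a ∈ B, r a b → ¬ a ≤ b}, fun b hb => hb.1, ?_, ?_⟩
  · refine Set.WellFoundedOn.mono' (fun a ha b hb (hab : b < a) => ?_) hr.wellFoundedOn
    rcases trichotomous_of r a b with h | h | h
    · exact h
    · exact absurd h.symm (ne_of_lt hab)
    · exact absurd (le_of_lt hab) (ha.2 b hb.1 h)
  · intro b hb
    obtain ⟨w, ⟨hwB, hwb⟩, hmin⟩ := hr.has_min {a ∈ B | a ≤ b} ⟨b, hb, le_rfl⟩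
    exact ⟨w, ⟨hwB, fun a ha haw hle => hmin a ⟨ha, hle.trans hwb⟩ haw⟩, hwb⟩

/-! ### Relative Scott open sets and filtrations -/

section Filtration

variable {P : Type*} [PartialOrder P]

theorem isOpen_scottTopology_iff {U : Set P} :
    IsOpen[scottTopology P] U ↔ IsUpperSet U ∧ DirSupInacc U := by
  let := scottTopology P
  have : Topology.IsScott P Set.univ := ⟨rfl⟩
  rw [Topology.IsScott.isOpen_iff_isUpperSet_and_dirSupInaccOn (D := Set.univ), dirSupInaccOn_univ]

theorem specializes_scottTopology_iff {x y : P} :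
    @Specializes P (scottTopology P) y x ↔ x ≤ y := by
  let := scottTopology P
  have : Topology.IsScott P Set.univ := ⟨rfl⟩
  rw [specializes_iff_mem_closure, Topology.IsScott.closure_singleton, Set.mem_Iic]

/-- The trace of `U` on `K` is an upper set of `K` and inaccessible by those directed suprema of `P`
that involve only elements of `K`. If suprema in `K` are suprema in `P`, this says that
the trace is Scott open in `K`; see `LfFiltration.isOpen_preimage_iff`. -/
def RelScottOpen (K U : Set P) : Prop :=
  (∀ x ∈ K, ∀ y ∈ K, x ≤ y → x ∈ U → y ∈ U) ∧
    ∀ D ⊆ K, D.Nonempty → DirectedOn (· ≤ ·) D → ∀ a ∈ K, IsLUB D a → a ∈ U → (D ∩ U).Nonempty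

theorem RelScottOpen.of_isOpen {U : Set P} (hU : IsOpen[scottTopology P] U) (K : Set P) :
    RelScottOpen K U := by
  rw [isOpen_scottTopology_iff] at hU
  exact ⟨fun x _ y _ hxy hx => hU.1 hxy hx, fun D _ hne hD a _ ha haU => hU.2 hne hD ha haU⟩

theorem RelScottOpen.iUnion {ι : Type*} {K : Set P} {U : ι → Set P}
    (hU : ∀ i, RelScottOpen K (U i)) : RelScottOpen K (⋃ i, U i) := by
  constructor
  · intro x hx y hy hxy hxU
    obtain ⟨i, hi⟩ := Set.mem_iUnion.1 hxU
    exact Set.mem_iUnion.2 ⟨i, (hU i).1 x hx y hy hxy hi⟩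
  · intro D hDK hne hD a haK ha haU
    obtain ⟨i, hi⟩ := Set.mem_iUnion.1 haU
    obtain ⟨d, hd, hdU⟩ := (hU i).2 D hDK hne hD a haK ha hi
    exact ⟨d, hd, Set.mem_iUnion.2 ⟨i, hdU⟩⟩

/-- An increasing exhaustion of `P` by subsets that witnesses that `P` is an `ℓf_ω`-poset, in a form
that passes to finite products. -/
structure LfFiltration (K : ℕ → Set P) : Prop where
  mono : Monotone K
  cover : ∀ x, ∃ n, x ∈ K n
  dirSupClosed : ∀ n, DirSupClosed (K n)
  /-- A supremum formed in `K n` is a supremum in `P`. -/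
  isLUB_of_rel : ∀ n, ∀ D ⊆ K n, D.Nonempty → DirectedOn (· ≤ ·) D → ∀ a ∈ K n,
    a ∈ upperBounds D → (∀ b ∈ K n, b ∈ upperBounds D → a ≤ b) → IsLUB D a
  /-- The relative Scott topology of `K n` is locally finite. -/
  exists_finite : ∀ n U, RelScottOpen (K n) U → ∀ x ∈ K n, x ∈ U →
    ∃ F : Set P, F.Finite ∧ x ∈ F ∧ F ⊆ K n ∩ U ∧ RelScottOpen (K n) (upperClosure F)
  /-- Every directed set generates the same ideal as a directed set inside some `K n`. -/
  exists_cofinal : ∀ D : Set P, D.Nonempty → DirectedOn (· ≤ ·) D → ∃ n, ∃ E ⊆ K n, E.Nonempty ∧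
    DirectedOn (· ≤ ·) E ∧ (∀ e ∈ E, ∃ d ∈ D, e ≤ d) ∧ ∀ d ∈ D, ∃ e ∈ E, d ≤ e

namespace LfFiltration

variable {K : ℕ → Set P}

theorem exists_finite_superset (h : LfFiltration K) {n : ℕ} {U : Set P}
    (hU : RelScottOpen (K n) U) {G : Set P} (hG : G.Finite) (hGU : G ⊆ K n ∩ U) :
    ∃ F : Set P, F.Finite ∧ G ⊆ F ∧ F ⊆ K n ∩ U ∧ RelScottOpen (K n) (upperClosure F) := by
  choose F hF hxF hFU hFo using fun x : G => h.exists_finite n U hU x (hGU x.2).1 (hGU x.2).2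
  have := hG.to_subtype
  refine ⟨⋃ x, F x, Set.finite_iUnion hF, fun x hx => Set.mem_iUnion.2 ⟨⟨x, hx⟩, hxF _⟩,
    Set.iUnion_subset hFU, ?_⟩
  have := RelScottOpen.iUnion hFo
  rwa [upperClosure_iUnion, UpperSet.coe_iInf]

/-- A sufficient condition for Scott openness that allows the stage of the filtration to grow. -/
theorem isOpen_of_forall_exists (h : LfFiltration K) {U : Set P} (hup : IsUpperSet U)
    (hU : ∀ a ∈ U, ∀ n, ∃ N ≥ n, ∃ V ⊆ U, a ∈ V ∧ RelScottOpen (K N) V) :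
    IsOpen[scottTopology P] U := by
  refine isOpen_scottTopology_iff.2 ⟨hup, fun D hne hD a ha haU => ?_⟩
  obtain ⟨n, E, hEK, hEne, hE, hED, hDE⟩ := h.exists_cofinal D hne hD
  obtain ⟨N, hN, V, hVU, haV, hV⟩ := hU a haU n
  have haE : IsLUB E a := ha.of_cofinal hED hDE
  have hEN := hEK.trans (h.mono hN)
  obtain ⟨e, he, heV⟩ := hV.2 E hEN hEne hE a (h.dirSupClosed N hEN hEne hE haE) haE haV
  obtain ⟨d, hd, hed⟩ := hED e he
  exact ⟨d, hd, hup hed (hVU heV)⟩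

theorem isOpen_iff (h : LfFiltration K) {U : Set P} :
    IsOpen[scottTopology P] U ↔ ∀ n, RelScottOpen (K n) U := by
  refine ⟨fun hU n => .of_isOpen hU _, fun hU => h.isOpen_of_forall_exists ?_
    fun a ha n => ⟨n, le_rfl, U, le_rfl, ha, hU n⟩⟩
  intro x y hxy hx
  obtain ⟨n, hn⟩ := h.cover x
  obtain ⟨m, hm⟩ := h.cover y
  exact (hU (max n m)).1 x (h.mono (le_max_left _ _) hn) y (h.mono (le_max_right _ _) hm) hxy hx

theorem isOpen_preimage_iff (h : LfFiltration K) {n : ℕ} {U : Set P} :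
    IsOpen[scottTopology (K n)] (Subtype.val ⁻¹' U) ↔ RelScottOpen (K n) U := by
  rw [isOpen_scottTopology_iff]
  constructor
  · rintro ⟨hup, hU⟩
    refine ⟨fun x hx y hy hxy hxU => hup (a := ⟨x, hx⟩) (b := ⟨y, hy⟩) hxy hxU, ?_⟩
    intro D hDK hne hD a haK ha haU
    obtain ⟨d, hd, hdU⟩ := @hU (Subtype.val ⁻¹' D) ⟨⟨hne.some, hDK hne.some_mem⟩, hne.some_mem⟩
      (fun x hx y hy => by
        obtain ⟨z, hz, h⟩ := hD x hx y hy
        exact ⟨⟨z, hDK hz⟩, hz, h⟩) ⟨a, haK⟩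
      ⟨fun d hd => ha.1 hd, fun b hb => ha.2 fun d hd =>
        hb (show (⟨d, hDK hd⟩ : K n) ∈ Subtype.val ⁻¹' D from hd)⟩ haU
    exact ⟨d, hd, hdU⟩
  · rintro ⟨hup, hU⟩
    refine ⟨fun x y hxy hx => hup x x.2 y y.2 hxy hx, fun D hne hD a ha haU => ?_⟩
    have hDK : Subtype.val '' D ⊆ K n := by
      rintro _ ⟨d, _, rfl⟩
      exact d.2
    have hD' : DirectedOn (· ≤ ·) (Subtype.val '' D) := by
      rintro _ ⟨x, hx, rfl⟩ _ ⟨y, hy, rfl⟩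
      obtain ⟨z, hz, h⟩ := hD x hx y hy
      exact ⟨z, ⟨z, hz, rfl⟩, h⟩
    obtain ⟨_, ⟨d, hd, rfl⟩, hdU⟩ := hU _ hDK (hne.image _) hD' a a.2
      (h.isLUB_of_rel n _ hDK (hne.image _) hD' a a.2
        (by rintro _ ⟨d, hd, rfl⟩; exact ha.1 hd)
        fun b hbK hb => ha.2 (show (⟨b, hbK⟩ : K n) ∈ upperBounds D from
          fun d hd => hb ⟨d, hd, rfl⟩)) haU
    exact ⟨d, hd, hdU⟩

theorem isLocallyFiniteSpace (h : LfFiltration K) (n : ℕ) :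
    @IsLocallyFiniteSpace (K n) (scottTopology (K n)) := by
  let := scottTopology (K n)
  have : Topology.IsScott (K n) Set.univ := ⟨rfl⟩
  refine ⟨inferInstance, fun x U hU hx => ?_⟩
  obtain ⟨V, rfl⟩ : ∃ V : Set P, U = Subtype.val ⁻¹' V :=
    ⟨_, (Set.preimage_image_eq U Subtype.val_injective).symm⟩
  have hV := h.isOpen_preimage_iff.1 hU
  obtain ⟨F, hF, hxF, hFV, hFo⟩ := h.exists_finite n V hV x x.2 hx
  have hup : specializationUp (Subtype.val ⁻¹' F : Set (K n)) =
      Subtype.val ⁻¹' (upperClosure F : Set P) := by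
    ext y
    simp only [specializationUp, Set.mem_ofPred_eq, Set.mem_preimage, SetLike.mem_coe,
      mem_upperClosure]
    constructor
    · rintro ⟨a, ha, hay⟩
      exact ⟨a, ha, (specializes_scottTopology_iff (P := K n)).1 hay⟩
    · rintro ⟨a, ha, hay⟩
      exact ⟨⟨a, (hFV ha).1⟩, ha, (specializes_scottTopology_iff (P := K n)).2 hay⟩
  refine ⟨Subtype.val ⁻¹' F, hF.preimage Subtype.val_injective.injOn, ?_⟩
  rw [hup]
  refine ⟨h.isOpen_preimage_iff.2 hFo, ⟨x, hxF, le_rfl⟩, ?_⟩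
  rintro y ⟨a, ha, hay⟩
  exact hV.1 a (hFV ha).1 y y.2 hay (hFV ha).2

theorem isLfOmegaPoset (h : LfFiltration K) : IsLfOmegaPoset P :=
  ⟨K, h.dirSupClosed, h.isLocallyFiniteSpace, fun _ _ hnm => h.mono hnm,
    Set.eq_univ_of_forall fun x => Set.mem_iUnion.2 (h.cover x),
    fun _ => h.isOpen_iff.trans (forall_congr' fun _ => h.isOpen_preimage_iff.symm)⟩

end LfFiltration

end Filtration

/-! ### Finite products -/

section Pi

variable {ι : Type*} {P : ι → Type*} [∀ i, PartialOrder (P i)]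

theorem isLUB_image_update [DecidableEq ι] (f : ∀ i, P i) (j : ι) {D : Set (P j)} {a : P j}
    (hne : D.Nonempty) (ha : IsLUB D a) :
    IsLUB (Function.update f j '' D) (Function.update f j a) := by
  refine ⟨?_, fun b hb => update_le_iff.2 ⟨ha.2 fun d hd => ?_, fun i hi => ?_⟩⟩
  · rintro _ ⟨d, hd, rfl⟩
    exact Function.update_mono (ha.1 hd)
  · simpa using hb ⟨d, hd, rfl⟩ j
  · simpa [hi] using hb ⟨hne.some, hne.some_mem, rfl⟩ i

theorem DirectedOn.image_of_monotone {A B : Type*} [Preorder A] [Preorder B] {f : A → B}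
    (hf : Monotone f) {D : Set A} (hD : DirectedOn (· ≤ ·) D) :
    DirectedOn (· ≤ ·) (f '' D) := by
  rintro _ ⟨x, hx, rfl⟩ _ ⟨y, hy, rfl⟩
  obtain ⟨z, hz, hxz, hyz⟩ := hD x hx y hy
  exact ⟨f z, ⟨z, hz, rfl⟩, hf hxz, hf hyz⟩

/-- The points `y` such that the box `A` with coordinate `j` replaced by `y` lies in `U` form a
finite intersection of sections of `U`, hence an open set. -/
theorem RelScottOpen.slice [DecidableEq ι] {K : ∀ i, Set (P i)} {U : Set (∀ i, P i)}
    (hU : RelScottOpen (Set.univ.pi K) U) {A : Set (∀ i, P i)} (hA : A.Finite)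
    (hAK : A ⊆ Set.univ.pi K) (j : ι) :
    RelScottOpen (K j) {y | ∀ f ∈ A, Function.update f j y ∈ U} := by
  have hmem : ∀ f ∈ A, ∀ y ∈ K j, Function.update f j y ∈ Set.univ.pi K := fun f hf y hy =>
    (Set.update_mem_pi_iff_of_mem (hAK hf)).2 fun _ => hy
  constructor
  · intro x hx y hy hxy hxU f hf
    exact hU.1 _ (hmem f hf x hx) _ (hmem f hf y hy) (Function.update_mono hxy) (hxU f hf)
  · intro D hDK hne hD a haK ha haU
    have : ∀ f, ∃ d ∈ D, f ∈ A → Function.update f j d ∈ U := by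
      intro f
      by_cases hf : f ∈ A
      · obtain ⟨_, ⟨d, hd, rfl⟩, hdU⟩ := hU.2 (Function.update f j '' D)
          (by rintro _ ⟨d, hd, rfl⟩; exact hmem f hf d (hDK hd)) (hne.image _)
          (hD.image_of_monotone fun _ _ h => Function.update_mono h) _ (hmem f hf a haK)
          (isLUB_image_update f j hne ha) (haU f hf)
        exact ⟨d, hd, fun _ => hdU⟩
      · exact ⟨hne.some, hne.some_mem, fun h => absurd h hf⟩
    choose g hgD hg using this
    obtain ⟨d, hd, hgd⟩ := hD.exists_upper_bound_of_finite hne hA g fun f _ => hgD f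
    exact ⟨d, hd, fun f hf => hU.1 _ (hmem f hf _ (hDK (hgD f))) _ (hmem f hf d (hDK hd))
      (Function.update_mono (hgd f hf)) (hg f hf)⟩

/-- A finite box inside a relatively open set can be enlarged to a finite box inside that set whose
sides generate open sets. -/
theorem exists_box [Finite ι] {K : ∀ i, ℕ → Set (P i)} (hK : ∀ i, LfFiltration (K i)) {n : ℕ}
    {U : Set (∀ i, P i)} (hU : RelScottOpen (Set.univ.pi fun i => K i n) U)
    {G : ∀ i, Set (P i)} (hG : ∀ i, (G i).Finite) (hGne : ∀ i, (G i).Nonempty)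
    (hGK : ∀ i, G i ⊆ K i n) (hGU : Set.univ.pi G ⊆ U) :
    ∃ F : ∀ i, Set (P i), (∀ i, (F i).Finite) ∧ (∀ i, G i ⊆ F i) ∧ (∀ i, F i ⊆ K i n) ∧
      Set.univ.pi F ⊆ U ∧ ∀ i, RelScottOpen (K i n) (upperClosure (F i)) := by
  classical
  suffices H : ∀ s : Set ι, ∃ F : ∀ i, Set (P i), (∀ i, (F i).Finite) ∧ (∀ i, G i ⊆ F i) ∧
      (∀ i, F i ⊆ K i n) ∧ Set.univ.pi F ⊆ U ∧
      ∀ i ∈ s, RelScottOpen (K i n) (upperClosure (F i)) by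
    obtain ⟨F, h1, h2, h3, h4, h5⟩ := H Set.univ
    exact ⟨F, h1, h2, h3, h4, fun i => h5 i trivial⟩
  intro s
  induction s, s.toFinite using Set.Finite.induction_on with
  | empty => exact ⟨G, hG, fun _ => le_rfl, hGK, hGU, by simp⟩
  | @insert j s hj _ ih =>
    obtain ⟨F, hF, hGF, hFK, hFU, hFo⟩ := ih
    have hV := hU.slice (.pi hF)
      (Set.pi_mono fun i _ => hFK i) j
    obtain ⟨F', hF', hFF', hF'V, hF'o⟩ := (hK j).exists_finite_superset hV (hF j)
      fun y hy => ⟨hFK j hy, fun f hf => hFU ((Set.update_mem_pi_iff_of_mem hf).2 fun _ => hy)⟩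
    refine ⟨Function.update F j F', fun i => ?_, fun i => ?_, fun i => ?_, ?_, fun i hi => ?_⟩
    · rcases eq_or_ne i j with rfl | hij
      · simpa using hF'
      · simpa [hij] using hF i
    · rcases eq_or_ne i j with rfl | hij
      · simpa using (hGF i).trans hFF'
      · simpa [hij] using hGF i
    · rcases eq_or_ne i j with rfl | hij
      · simpa using hF'V.trans Set.inter_subset_left
      · simpa [hij] using hFK i
    · intro f hf
      have hfj : f j ∈ F' := by simpa using hf j trivial
      obtain ⟨y, hy⟩ := (hGne j).mono (hGF j)
      have hfy : Function.update f j y ∈ Set.univ.pi F := by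
        intro i _
        rcases eq_or_ne i j with rfl | hij
        · simpa using hy
        · simpa [hij] using hf i trivial
      simpa using (hF'V hfj).2 _ hfy
    · rcases eq_or_ne i j with rfl | hij
      · simpa using hF'o
      · simpa [hij] using hFo i (Set.mem_of_mem_insert_of_ne hi hij)

theorem LfFiltration.pi [Finite ι] {K : ∀ i, ℕ → Set (P i)} (hK : ∀ i, LfFiltration (K i)) :
    LfFiltration fun n => Set.univ.pi fun i => K i n := by
  classical
  have hdir : ∀ {D : Set (∀ i, P i)}, DirectedOn (· ≤ ·) D → ∀ i,
      DirectedOn (· ≤ ·) (Function.eval i '' D) := fun hD i =>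
    hD.image_of_monotone (Function.monotone_eval i)
  have hsub : ∀ {D : Set (∀ i, P i)} {n : ℕ}, (D ⊆ Set.univ.pi fun i => K i n) → ∀ i,
      Function.eval i '' D ⊆ K i n := by
    rintro D n hDK i _ ⟨d, hd, rfl⟩
    exact hDK hd i trivial
  refine ⟨fun n m hnm => Set.pi_mono fun i _ => (hK i).mono hnm, fun x => ?_, ?_, ?_, ?_, ?_⟩
  · choose n hn using fun i => (hK i).cover (x i)
    obtain ⟨N, hN⟩ := Finite.exists_le n
    exact ⟨N, fun i _ => (hK i).mono (hN i) (hn i)⟩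
  · intro n D hDK hne hD a ha i _
    exact (hK i).dirSupClosed n (hsub hDK i) (hne.image _) (hdir hD i) (isLUB_pi.1 ha i)
  · intro n D hDK hne hD a haK hub hleast
    refine isLUB_pi.2 fun i => (hK i).isLUB_of_rel n _ (hsub hDK i) (hne.image _) (hdir hD i) _
      (haK i trivial) ?_ fun b hbK hb => ?_
    · rintro _ ⟨d, hd, rfl⟩
      exact hub hd i
    · simpa using hleast (Function.update a i b)
        ((Set.update_mem_pi_iff_of_mem haK).2 fun _ => hbK)
        (fun d hd => le_update_iff.2 ⟨hb ⟨d, hd, rfl⟩, fun k _ => hub hd k⟩) i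
  · intro n U hU x hxK hxU
    obtain ⟨F, hF, hxF, hFK, hFU, hFo⟩ := exists_box hK hU (G := fun i => {x i})
      (fun i => Set.finite_singleton _) (fun i => Set.singleton_nonempty _)
      (fun i => Set.singleton_subset_iff.2 (hxK i trivial))
      (by rw [Set.univ_pi_singleton]; simpa using hxU)
    refine ⟨Set.univ.pi F, Set.Finite.pi hF,
      fun i _ => hxF i rfl, fun f hf => ⟨fun i _ => hFK i (hf i trivial), hFU hf⟩, ?_, ?_⟩
    · rintro y _ z _ hyz ⟨f, hf, hfy⟩
      exact ⟨f, hf, hfy.trans hyz⟩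
    · rintro D hDK hne hD a haK ha ⟨f, hf, hfa⟩
      have : ∀ i, ∃ d ∈ D, ∃ g ∈ F i, g ≤ d i := by
        intro i
        obtain ⟨_, ⟨d, hd, rfl⟩, hdF⟩ := (hFo i).2 _ (hsub hDK i) (hne.image _) (hdir hD i) (a i)
          (haK i trivial) (isLUB_pi.1 ha i) ⟨f i, hf i trivial, hfa i⟩
        exact ⟨d, hd, hdF⟩
      choose d hd g hg hgd using this
      obtain ⟨e, he, hde⟩ := hD.exists_upper_bound_of_finite hne Set.finite_univ d fun i _ => hd i
      exact ⟨e, he, g, fun i _ => hg i, fun i => (hgd i).trans (hde i trivial i)⟩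
  · intro D hne hD
    choose n E hEK hEne hE hED hDE using fun i =>
      (hK i).exists_cofinal _ (hne.image (Function.eval i)) (hdir hD i)
    obtain ⟨N, hN⟩ := Finite.exists_le n
    refine ⟨N, Set.univ.pi E, fun e he i _ => (hK i).mono (hN i) (hEK i (he i trivial)),
      Set.univ_pi_nonempty_iff.2 hEne, ?_, ?_, ?_⟩
    · intro x hx y hy
      choose z hz hxz hyz using fun i => hE i (x i) (hx i trivial) (y i) (hy i trivial)
      exact ⟨z, fun i _ => hz i, hxz, hyz⟩
    · intro e he
      have : ∀ i, ∃ d ∈ D, e i ≤ d i := by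
        intro i
        obtain ⟨_, ⟨d, hd, rfl⟩, hed⟩ := hED i (e i) (he i trivial)
        exact ⟨d, hd, hed⟩
      choose d hd hed using this
      obtain ⟨u, hu, hdu⟩ := hD.exists_upper_bound_of_finite hne Set.finite_univ d fun i _ => hd i
      exact ⟨u, hu, fun i => (hed i).trans (hdu i trivial i)⟩
    · intro d hd
      choose e he hde using fun i => hDE i (d i) ⟨d, hd, rfl⟩
      exact ⟨e, fun i _ => he i, hde⟩

/-- The projections of a product are Scott continuous. -/
theorem scottTopology_le_pi :
    scottTopology (∀ i, P i) ≤ @Pi.topologicalSpace ι P fun i => scottTopology (P i) := by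
  refine le_iInf fun i => continuous_iff_le_induced.1 ?_
  refine @Continuous.mk _ _ (scottTopology _) (scottTopology _) _ fun U hU => ?_
  rw [isOpen_scottTopology_iff] at hU ⊢
  refine ⟨fun x y hxy hx => hU.1 (hxy i) hx, fun D hne hD a ha haU => ?_⟩
  obtain ⟨_, ⟨d, hd, rfl⟩, hdU⟩ := hU.2 (hne.image _)
    (hD.image_of_monotone (Function.monotone_eval i)) (isLUB_pi.1 ha i) haU
  exact ⟨d, hd, hdU⟩

/-- Around each point of a Scott open set of the product there is a box of Scott open sets: it is
generated by an increasing sequence of finite boxes, the `m`-th of which has sides generating open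
sets of the stage `n + m` of the filtrations. -/
theorem exists_isOpen_box [Finite ι] {K : ∀ i, ℕ → Set (P i)} (hK : ∀ i, LfFiltration (K i))
    {U : Set (∀ i, P i)} (hU : IsOpen[scottTopology (∀ i, P i)] U) {x : ∀ i, P i} (hx : x ∈ U) :
    ∃ V : ∀ i, Set (P i), (∀ i, IsOpen[scottTopology (P i)] (V i) ∧ x i ∈ V i) ∧
      Set.univ.pi V ⊆ U := by
  have hUK := fun n => RelScottOpen.of_isOpen hU (Set.univ.pi fun i => K i n)
  obtain ⟨n, hn⟩ := (LfFiltration.pi hK).cover x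
  let Good : ℕ → (∀ i, Set (P i)) → Prop := fun m F =>
    (∀ i, (F i).Finite) ∧ (∀ i, x i ∈ F i) ∧ (∀ i, F i ⊆ K i (n + m)) ∧ Set.univ.pi F ⊆ U ∧
      ∀ i, RelScottOpen (K i (n + m)) (upperClosure (F i))
  have hzero : ∃ F, Good 0 F := by
    obtain ⟨F, hF, hxF, hrest⟩ := exists_box hK (hUK n) (G := fun i => {x i})
      (fun i => Set.finite_singleton _) (fun i => Set.singleton_nonempty _)
      (fun i => Set.singleton_subset_iff.2 (hn i trivial))
      (by rw [Set.univ_pi_singleton]; simpa using hx)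
    exact ⟨F, hF, fun i => hxF i rfl, hrest⟩
  have hstep : ∀ m F, Good m F → ∃ F', Good (m + 1) F' ∧ ∀ i, F i ⊆ F' i := by
    rintro m F ⟨hF, hxF, hFK, hFU, -⟩
    obtain ⟨F', hF', hFF', hrest⟩ := exists_box hK (hUK (n + (m + 1))) hF
      (fun i => ⟨_, hxF i⟩) (fun i => (hFK i).trans ((hK i).mono (by omega))) hFU
    exact ⟨F', ⟨hF', fun i => hFF' i (hxF i), hrest⟩, hFF'⟩
  obtain ⟨F₀, hF₀⟩ := hzero
  choose next hnext hsub using hstep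
  let S : ∀ m, {F // Good m F} := fun m =>
    Nat.rec ⟨F₀, hF₀⟩ (fun m F => ⟨next m F.1 F.2, hnext m F.1 F.2⟩) m
  have hmono : ∀ i, Monotone fun m => (S m).1 i := fun i =>
    monotone_nat_of_le_succ fun m => hsub m (S m).1 (S m).2 i
  refine ⟨fun i => ⋃ m, (upperClosure ((S m).1 i) : Set (P i)), fun i => ⟨?_, ?_⟩, ?_⟩
  · refine (hK i).isOpen_of_forall_exists (isUpperSet_iUnion fun m => UpperSet.upper _)
      fun a ha k => ?_
    obtain ⟨m, b, hb, hba⟩ := Set.mem_iUnion.1 ha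
    exact ⟨n + max k m, by omega, _, Set.subset_iUnion _ (max k m),
      ⟨b, hmono i (le_max_right _ _) hb, hba⟩, (S (max k m)).2.2.2.2.2 i⟩
  · exact Set.mem_iUnion.2 ⟨0, x i, (S 0).2.2.1 i, le_rfl⟩
  · intro y hy
    choose m hm using fun i => Set.mem_iUnion.1 (hy i trivial)
    choose b hb hby using hm
    obtain ⟨M, hM⟩ := Finite.exists_le m
    have hup := (isOpen_scottTopology_iff.1 hU).1
    exact hup (a := b) hby ((S M).2.2.2.2.1 fun i _ => hmono i (hM i) (hb i))

theorem scottTopology_pi [Finite ι] {K : ∀ i, ℕ → Set (P i)} (hK : ∀ i, LfFiltration (K i)) :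
    scottTopology (∀ i, P i) = @Pi.topologicalSpace ι P fun i => scottTopology (P i) := by
  refine le_antisymm scottTopology_le_pi fun U hU => ?_
  let := fun i => scottTopology (P i)
  exact isOpen_pi_iff'.2 fun x hx => exists_isOpen_box hK hU hx

theorem IsDcpo.pi (hP : ∀ i, IsDcpo (P i)) : IsDcpo (∀ i, P i) := by
  intro D hne hD
  choose a ha using fun i => hP i _ (hne.image (Function.eval i))
    (hD.image_of_monotone (Function.monotone_eval i))
  exact ⟨a, isLUB_pi.2 ha⟩

end Pi

/-! ### Filtrations of `c`-posets -/

section CPoset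

variable {P : Type*}

/-- Stage `n` of the filtration of a `c`-poset with chains `c k` and sets `T l` without nonprincipal
ideals. The sets `W k`, in the application a coinitial set of upper bounds of the chain `c k`, make
suprema in the stage agree with suprema in `P`. -/
def cPosetStage {N : Set ℕ} (c : N → ℕ → P) (W : N → Set P) (T : ℕ → Set P) (n : ℕ) : Set P :=
  (⋃ k ∈ {k : N | k.1 ≤ n}, Set.range (c k) ∪ W k) ∪ ⋃ l ∈ Set.Iic n, T l

theorem finite_setOf_val_le (N : Set ℕ) (n : ℕ) : {k : N | k.1 ≤ n}.Finite :=
  (Set.finite_Iic n).preimage Subtype.val_injective.injOn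

section Stage

variable {N : Set ℕ} {c : N → ℕ → P} {W : N → Set P} {T : ℕ → Set P}

theorem range_subset_cPosetStage {n : ℕ} {k : N} (hk : k.1 ≤ n) :
    Set.range (c k) ⊆ cPosetStage c W T n := fun _ hx =>
  Or.inl (Set.mem_iUnion₂.2 ⟨k, hk, Or.inl hx⟩)

theorem bounds_subset_cPosetStage {n : ℕ} {k : N} (hk : k.1 ≤ n) :
    W k ⊆ cPosetStage c W T n := fun _ hx =>
  Or.inl (Set.mem_iUnion₂.2 ⟨k, hk, Or.inr hx⟩)

variable [PartialOrder P]

/-- If the terms of an ascending sequence that lie in a directed set are cofinal in it, the directed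
set has a greatest element or is cofinal with the whole sequence. -/
theorem DirectedOn.exists_greatest_or_cofinal_range {D : Set P} (hD : DirectedOn (· ≤ ·) D)
    (hne : D.Nonempty) {c : ℕ → P} (hc : Monotone c)
    (hDc : ∀ d ∈ D, ∃ e ∈ D ∩ Set.range c, d ≤ e) :
    (∃ x, IsGreatest D x) ∨ (∀ d ∈ D, ∃ e ∈ Set.range c, d ≤ e) ∧
      ∀ e ∈ Set.range c, ∃ d ∈ D, e ≤ d := by
  by_cases h : ∀ e ∈ Set.range c, ∃ d ∈ D, e ≤ d
  · refine Or.inr ⟨fun d hd => ?_, h⟩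
    obtain ⟨e, he, hde⟩ := hDc d hd
    exact ⟨e, he.2, hde⟩
  · -- The elements of the sequence that belong to `D` come before some `c m`, so they are finite in
    -- number, and an upper bound of them in `D` is the greatest element.
    left
    push Not at h
    obtain ⟨_, ⟨m, rfl⟩, hm⟩ := h
    obtain ⟨x, hx, hub⟩ := hD.exists_upper_bound_of_finite hne
      (((Set.finite_Iio m).image c).inter_of_right D) id fun e he => he.1
    refine ⟨x, hx, fun d hd => ?_⟩
    obtain ⟨_, ⟨heD, k, rfl⟩, hde⟩ := hDc d hd
    have hkm : k < m := lt_of_not_ge fun hmk => hm _ heD (hc hmk)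
    exact hde.trans (hub _ ⟨heD, k, hkm, rfl⟩)

/-- Inside a stage there are, up to cofinality, only finitely many directed sets without a greatest
element. -/
theorem exists_greatest_or_cofinal_chain (hc : ∀ k, Monotone (c k))
    (hW : ∀ k, (W k).WellFoundedOn (· > ·)) (hT : ∀ l, nonPrincipalIdeals (T l) = ∅) {n : ℕ}
    {D : Set P} (hDK : D ⊆ cPosetStage c W T n) (hne : D.Nonempty) (hD : DirectedOn (· ≤ ·) D) :
    (∃ x, IsGreatest D x) ∨ ∃ k : N, k.1 ≤ n ∧ (∀ d ∈ D, ∃ e ∈ Set.range (c k), d ≤ e) ∧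
      ∀ e ∈ Set.range (c k), ∃ d ∈ D, e ≤ d := by
  have hgreatest : ∀ A : Set P, (∀ d ∈ D, ∃ e ∈ D ∩ A, d ≤ e) → (∃ x, IsGreatest (D ∩ A) x) →
      ∃ x, IsGreatest D x := by
    rintro A hA ⟨x, hx, hub⟩
    refine ⟨x, hx.1, fun d hd => ?_⟩
    obtain ⟨e, he, hde⟩ := hA d hd
    exact hde.trans (hub he)
  have hneA : ∀ A : Set P, (∀ d ∈ D, ∃ e ∈ D ∩ A, d ≤ e) → (D ∩ A).Nonempty := fun A hA =>
    let ⟨e, he, _⟩ := hA hne.some hne.some_mem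
    ⟨e, he⟩
  let A : (N ⊕ N) ⊕ ℕ → Set P := Sum.elim (Sum.elim (fun k => Set.range (c k)) W) T
  let s : Set ((N ⊕ N) ⊕ ℕ) :=
    Sum.inl '' (Sum.inl '' {k | k.1 ≤ n} ∪ Sum.inr '' {k | k.1 ≤ n}) ∪ Sum.inr '' Set.Iic n
  have hs : s.Finite :=
    ((((finite_setOf_val_le N n).image _).union ((finite_setOf_val_le N n).image _)).image _).union
      ((Set.finite_Iic n).image _)
  have hDA : D ⊆ ⋃ i ∈ s, A i := by
    intro d hd
    rw [Set.mem_iUnion₂]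
    rcases hDK hd with h | h
    · obtain ⟨k, hk, h | h⟩ := Set.mem_iUnion₂.1 h
      · exact ⟨Sum.inl (Sum.inl k), Or.inl ⟨_, Or.inl ⟨k, hk, rfl⟩, rfl⟩, h⟩
      · exact ⟨Sum.inl (Sum.inr k), Or.inl ⟨_, Or.inr ⟨k, hk, rfl⟩, rfl⟩, h⟩
    · obtain ⟨l, hl, h⟩ := Set.mem_iUnion₂.1 h
      exact ⟨Sum.inr l, Or.inr ⟨l, hl, rfl⟩, h⟩
  obtain ⟨i, hi, hcof⟩ := hD.exists_cofinal_piece hne hs A hDA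
  rcases hi with ⟨_, ⟨k, hk, rfl⟩ | ⟨k, hk, rfl⟩, rfl⟩ | ⟨l, hl, rfl⟩
  · exact (hD.exists_greatest_or_cofinal_range hne (hc k) hcof).imp_right fun h => ⟨k, hk, h⟩
  · exact Or.inl (hgreatest _ hcof ((hD.of_cofinal_piece hcof).exists_greatest_of_wellFoundedOn
      (hW k) Set.inter_subset_right (hneA _ hcof)))
  · exact Or.inl (hgreatest _ hcof
      ((hD.of_cofinal_piece hcof).exists_greatest_of_nonPrincipalIdeals_eq_empty
        (hT l) Set.inter_subset_right (hneA _ hcof)))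

theorem dirSupClosed_cPosetStage (hc : ∀ k, Monotone (c k))
    (hW : ∀ k, (W k).WellFoundedOn (· > ·)) (hT : ∀ l, nonPrincipalIdeals (T l) = ∅)
    (hWub : ∀ k, W k ⊆ upperBounds (Set.range (c k)))
    (hWco : ∀ k, ∀ b ∈ upperBounds (Set.range (c k)), ∃ w ∈ W k, w ≤ b) (n : ℕ) :
    DirSupClosed (cPosetStage c W T n) := by
  intro D hDK hne hD a ha
  rcases exists_greatest_or_cofinal_chain hc hW hT hDK hne hD with ⟨x, hx⟩ | ⟨k, hk, hDc, hcD⟩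
  · rw [ha.unique hx.isLUB]
    exact hDK hx.1
  · have hac : IsLUB (Set.range (c k)) a := ha.of_cofinal hcD hDc
    obtain ⟨w, hw, hwa⟩ := hWco k a hac.1
    rw [le_antisymm (hac.2 (hWub k hw)) hwa]
    exact bounds_subset_cPosetStage hk hw

/-- In an open set of a stage, adjoin to `{x}` one element of each of the finitely many chains with
supremum in that set: the upper set generated by these elements is open. -/
theorem exists_finite_cPosetStage (hc : ∀ k, Monotone (c k))
    (hW : ∀ k, (W k).WellFoundedOn (· > ·)) (hT : ∀ l, nonPrincipalIdeals (T l) = ∅) {n : ℕ}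
    {U : Set P} (hU : RelScottOpen (cPosetStage c W T n) U) {x : P}
    (hx : x ∈ cPosetStage c W T n) (hxU : x ∈ U) :
    ∃ F : Set P, F.Finite ∧ x ∈ F ∧ F ⊆ cPosetStage c W T n ∩ U ∧
      RelScottOpen (cPosetStage c W T n) (upperClosure F) := by
  have hpick : ∀ k : N, ∃ G : Set P, G.Finite ∧ (k.1 ≤ n → G ⊆ cPosetStage c W T n ∩ U) ∧
      (k.1 ≤ n → ∀ a ∈ cPosetStage c W T n, IsLUB (Set.range (c k)) a → a ∈ U →
        (Set.range (c k) ∩ G).Nonempty) := by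
    intro k
    by_cases h : (Set.range (c k) ∩ U).Nonempty
    · obtain ⟨e, he, heU⟩ := h
      exact ⟨{e}, Set.finite_singleton e,
        fun hk => Set.singleton_subset_iff.2 ⟨range_subset_cPosetStage hk he, heU⟩,
        fun _ _ _ _ _ => ⟨e, he, rfl⟩⟩
    · refine ⟨∅, Set.finite_empty, fun _ => Set.empty_subset _, fun hk a haK ha haU => ?_⟩
      exact absurd (hU.2 _ (range_subset_cPosetStage hk) (Set.range_nonempty _)
        ((hc k).directed_le.directedOn_range) a haK ha haU) h
  choose G hG hGU hGc using hpick
  have hFU : insert x (⋃ k ∈ {k : N | k.1 ≤ n}, G k) ⊆ cPosetStage c W T n ∩ U :=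
    Set.insert_subset ⟨hx, hxU⟩ (Set.iUnion₂_subset fun k hk => hGU k hk)
  refine ⟨insert x (⋃ k ∈ {k : N | k.1 ≤ n}, G k),
    ((finite_setOf_val_le N n).biUnion fun k _ => hG k).insert x, Set.mem_insert _ _, hFU, ?_, ?_⟩
  · rintro y _ z _ hyz ⟨f, hf, hfy⟩
    exact ⟨f, hf, hfy.trans hyz⟩
  · rintro D hDK hne hD a haK ha ⟨f, hf, hfa⟩
    rcases exists_greatest_or_cofinal_chain hc hW hT hDK hne hD with ⟨y, hy⟩ | ⟨k, hk, hDc, hcD⟩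
    · obtain rfl := ha.unique hy.isLUB
      exact ⟨a, hy.1, f, hf, hfa⟩
    · have haU : a ∈ U := hU.1 f (hFU hf).1 a haK hfa (hFU hf).2
      obtain ⟨e, he, heG⟩ := hGc k hk a haK (ha.of_cofinal hcD hDc) haU
      obtain ⟨d, hd, hed⟩ := hcD e he
      exact ⟨d, hd, e, Or.inr (Set.mem_iUnion₂.2 ⟨k, hk, heG⟩), hed⟩

theorem isLUB_of_rel_cPosetStage (hc : ∀ k, Monotone (c k))
    (hW : ∀ k, (W k).WellFoundedOn (· > ·)) (hT : ∀ l, nonPrincipalIdeals (T l) = ∅)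
    (hWub : ∀ k, W k ⊆ upperBounds (Set.range (c k)))
    (hWco : ∀ k, ∀ b ∈ upperBounds (Set.range (c k)), ∃ w ∈ W k, w ≤ b) {n : ℕ} {D : Set P}
    (hDK : D ⊆ cPosetStage c W T n) (hne : D.Nonempty) (hD : DirectedOn (· ≤ ·) D) {a : P}
    (hub : a ∈ upperBounds D)
    (hleast : ∀ b ∈ cPosetStage c W T n, b ∈ upperBounds D → a ≤ b) : IsLUB D a := by
  refine ⟨hub, fun b hb => ?_⟩
  rcases exists_greatest_or_cofinal_chain hc hW hT hDK hne hD with ⟨x, hx⟩ | ⟨k, hk, hDc, hcD⟩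
  · exact (hleast x (hDK hx.1) hx.2).trans (hb hx.1)
  · obtain ⟨w, hw, hwb⟩ := hWco k b fun e he =>
      let ⟨d, hd, hed⟩ := hcD e he
      hed.trans (hb hd)
    refine (hleast w (bounds_subset_cPosetStage hk hw) fun d hd => ?_).trans hwb
    obtain ⟨e, he, hde⟩ := hDc d hd
    exact hde.trans (hWub k hw he)

end Stage

theorem IsCPoset.exists_lfFiltration [PartialOrder P] (hP : IsCPoset P) :
    ∃ K : ℕ → Set P, LfFiltration K := by
  obtain ⟨N, I, c, T, hI, hcI, hcover, hT⟩ := hP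
  have hc : ∀ k, Monotone (c k) := fun k => (hcI k).1.monotone
  choose W hWub hW hWco using fun k => exists_coinitial_wellFounded (upperBounds (Set.range (c k)))
  have hcov : ∀ x, ∃ n, x ∈ cPosetStage c W T n := by
    intro x
    by_cases hx : x ∈ ⋃ k, (Set.range (c k) ∪ {x | IsLUB (Set.range (c k)) x})
    · obtain ⟨k, hx | hx⟩ := Set.mem_iUnion.1 hx
      · exact ⟨k, range_subset_cPosetStage le_rfl hx⟩
      · exact ⟨k, dirSupClosed_cPosetStage hc hW hT hWub hWco k (range_subset_cPosetStage le_rfl)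
          (Set.range_nonempty _) (hc k).directed_le.directedOn_range hx⟩
    · have hx' : x ∈ ⋃ l, T l := hcover ▸ hx
      obtain ⟨l, hl⟩ := Set.mem_iUnion.1 hx'
      exact ⟨l, Or.inr (Set.mem_iUnion₂.2 ⟨l, Set.mem_Iic.2 le_rfl, hl⟩)⟩
  refine ⟨cPosetStage c W T, ?_, hcov, dirSupClosed_cPosetStage hc hW hT hWub hWco,
    fun n D hDK hne hD a _ => isLUB_of_rel_cPosetStage hc hW hT hWub hWco hDK hne hD,
    fun n U hU x hx => exists_finite_cPosetStage hc hW hT hU hx, fun D hne hD => ?_⟩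
  · intro n m hnm
    exact Set.union_subset_union
      (Set.biUnion_subset_biUnion_left fun k (hk : k.1 ≤ n) => hk.trans hnm)
      (Set.biUnion_subset_biUnion_left (Set.Iic_subset_Iic.2 hnm))
  · by_cases hnp : hD.lowerIdeal hne ∈ nonPrincipalIdeals P
    · rw [hI] at hnp
      obtain ⟨k, hk⟩ := hnp
      have hmem : ∀ x, (∃ d ∈ D, x ≤ d) ↔ ∃ m, x ≤ c k m := fun x => by
        rw [← hD.mem_lowerIdeal hne, ← hk, ← SetLike.mem_coe, (hcI k).2, Set.mem_ofPred_eq]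
      refine ⟨k, Set.range (c k), range_subset_cPosetStage le_rfl, Set.range_nonempty _,
        (hc k).directed_le.directedOn_range, ?_, fun d hd => ?_⟩
      · rintro _ ⟨m, rfl⟩
        exact (hmem _).2 ⟨m, le_rfl⟩
      · obtain ⟨m, hm⟩ := (hmem d).1 ⟨d, hd, le_rfl⟩
        exact ⟨_, ⟨m, rfl⟩, hm⟩
    · simp only [nonPrincipalIdeals, Set.mem_ofPred_eq, not_forall, not_not] at hnp
      obtain ⟨x, hx⟩ := hnp
      have hg := hD.exists_greatest_of_lowerIdeal_eq hne hx
      obtain ⟨n, hn⟩ := hcov x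
      exact ⟨n, {x}, Set.singleton_subset_iff.2 hn, Set.singleton_nonempty x,
        directedOn_singleton x, fun e he => ⟨x, hg.1, le_of_eq he⟩,
        fun d hd => ⟨x, rfl, hg.2 hd⟩⟩

end CPoset

theorem corollary4p21 (n : ℕ) (P : Fin n → Type*) [∀ i, PartialOrder (P i)] :
    ((∀ i, IsCPoset (P i)) →
      IsLfOmegaPoset (∀ i, P i) ∧
        scottTopology (∀ i, P i) = @Pi.topologicalSpace (Fin n) P fun i => scottTopology (P i)) ∧
    ((∀ i, IsCDcpo (P i)) →
      IsLfOmegaDcpo (∀ i, P i) ∧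
        scottTopology (∀ i, P i) = @Pi.topologicalSpace (Fin n) P fun i => scottTopology (P i)) := by
  have main : (∀ i, IsCPoset (P i)) → IsLfOmegaPoset (∀ i, P i) ∧
      scottTopology (∀ i, P i) =
        @Pi.topologicalSpace (Fin n) P fun i => scottTopology (P i) := by
    intro h
    choose K hK using fun i => (h i).exists_lfFiltration
    exact ⟨(LfFiltration.pi hK).isLfOmegaPoset, scottTopology_pi hK⟩
  exact ⟨main, fun h => ⟨⟨IsDcpo.pi fun i => (h i).1, (main fun i => (h i).2).1⟩,
    (main fun i => (h i).2).2⟩⟩
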